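/- Let $X$ be a smooth projective variety over $\mathbb C$ (irreducibility is not needed), let $G$ be a finite group acting on $X$ by automorphisms over $\mathbb C$, and let $D^b(X)$ be the bounded derived category of coherent sheaves on $X$. For $g,h\in G$ identify $(gh)^*$ with $h^*g^*$ and $1^*$ with the identity by the canonical isomorphisms. Let $E\in D^b(X)$ be simple, i.e. $\operatorname{Hom}(E,E)=\mathbb C$, and $G$-invariant, i.e. $E\cong g^*E$ for all $g\in G$. A $G$-linearisation of $E$ is a family of isomorphisms $\lambda_g:E\to g^*E$ in $D^b(X)$ $(g\in G)$ with $\lambda_1=\mathrm{id}_E$ and $\lambda_{gh}=h^*\lambda_g\circ\lambda_h$; two linearisations $\lambda,\lambda'$ are isomorphic if there is an automorphism $f$ of $E$ with $g^*f\circ\lambda_g=\lambda'_g\circ f$ for all $g$. Then: (1) There is a unique class $[E]\in H^2(G,\mathbb C^*)$ (trivial action on $\mathbb C^*$) such that, for every choice of isomorphisms $\mu_g:E\to g^*E$, there are units $c_{g,h}\in\mathbb C^*$ with $\mu_{gh}=c_{g,h}\cdot(h^*\mu_g\circ\mu_h)$ which form a $2$-cocycle of class $[E]$. (2) $E$ admits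 a $G$-linearisation if and only if $[E]=0$. (3) If $[E]=0$, then the set of isomorphism classes of $G$-linearisations of $E$ is a torsor under the character group $\hat G=\operatorname{Hom}(G,\mathbb C^*)$ for the action $(\chi\cdot\lambda)_g=\chi(g)\lambda_g$: it is non-empty and $\hat G$ acts on it simply transitively. -/

import Mathlib

open CategoryTheory Limits AlgebraicGeometry

namespace EquivariantSheaves
noncomputable section

/-- The base `Spec ℂ`. -/
abbrev SpecC : Scheme.{0} := Spec (.of ℂ)

attribute [local instance] MvPolynomial.gradedAlgebra
/-- Projective `n`-space over `ℂ`. -/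
def projSpace (n : ℕ) : Scheme.{0} :=
  Proj (MvPolynomial.homogeneousSubmodule (Fin (n + 1)) ℂ)

/-- The structure morphism of projective space. -/
def projSpaceToSpecC (n : ℕ) : projSpace n ⟶ SpecC :=
  Proj.toSpecZero (MvPolynomial.homogeneousSubmodule (Fin (n + 1)) ℂ) ≫
    Spec.map (CommRingCat.ofHom
      (algebraMap ℂ (MvPolynomial.homogeneousSubmodule (Fin (n + 1)) ℂ 0)))

/-- `X` is projective over `ℂ`: it is a closed subscheme of some projective space over `ℂ`. -/
def IsProjective (X : Scheme.{0}) [X.Over SpecC] : Prop :=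
  ∃ (n : ℕ) (i : X ⟶ projSpace n), IsClosedImmersion i ∧ i ≫ projSpaceToSpecC n = X ↘ SpecC

section Linear
variable (X : Scheme.{0}) [X.Over SpecC]

/-- The structure map `ℂ → Γ(X, U)` of a complex scheme. -/
def scalar (U : X.Opens) : ℂ →+* Γ(X, U) :=
  ((Scheme.ΓSpecIso (.of ℂ)).inv ≫ (X ↘ SpecC).appTop ≫ X.presheaf.map (homOfLE le_top).op).hom

variable {X} in
lemma scalar_map {U V : X.Opens} (i : U ⟶ V) (a : ℂ) :
    X.presheaf.map i.op (scalar X V a) = scalar X U a := by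
  have : (Scheme.ΓSpecIso (.of ℂ)).inv ≫ (X ↘ SpecC).appTop ≫
      X.presheaf.map (homOfLE (le_top : U ≤ ⊤)).op = ((Scheme.ΓSpecIso (.of ℂ)).inv ≫
      (X ↘ SpecC).appTop ≫ X.presheaf.map (homOfLE (le_top : V ≤ ⊤)).op) ≫
        X.presheaf.map i.op := by
    simp only [Category.assoc, ← Functor.map_comp]
    rfl
  rw [scalar, scalar, this]
  rfl

/-- Multiplication by `a : ℂ` as an endomorphism of an `𝒪_X`-module. -/
def scalarEnd (M : X.Modules) (a : ℂ) : M ⟶ M where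
  val := PresheafOfModules.homMk (M₁ := M.val) (M₂ := M.val)
    { app := fun U => M.smul (scalar X U.unop a)
      naturality := fun U V i => by
        ext x
        have := (Scheme.Modules.map_smul M i.unop (scalar X U.unop a) x)
        rw [scalar_map] at this
        exact this.symm }
    (fun U r x => by
      exact smul_comm (M := Γ(X, U.unop)) (N := Γ(X, U.unop)) (α := Γ(M, U.unop))
        (scalar X U.unop a) r x)

lemma scalarEnd_app (M : X.Modules) (a : ℂ) (U : X.Opens) (x : Γ(M, U)) :
    (scalarEnd X M a).app U x = scalar X U a • x := rfl

/-- Complex scalars act on all `𝒪_X`-modules, naturally. -/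
def toCatCenter : ℂ →+* CatCenter X.Modules where
  toFun a :=
    { app := fun M => scalarEnd X M a
      naturality := fun M N f => by
        ext U x
        exact ((Scheme.Modules.Hom.app_smul f (scalar X U a) x)).symm }
  map_one' := by
    ext M U x
    change scalar X U 1 • x = x
    simp
  map_mul' a b := by
    ext M U x
    rw [CatCenter.mul_app']
    change scalar X U (a * b) • x = scalar X U a • scalar X U b • x
    rw [map_mul, mul_smul]
  map_zero' := by
    ext M U x
    change scalar X U 0 • x = 0
    simp
  map_add' a b := by
    ext M U x
    change scalar X U (a + b) • x = scalar X U a • x + scalar X U b • x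
    rw [map_add, add_smul]

/-- `𝒪_X`-modules form a `ℂ`-linear category, with `(a • f)(x) = a • f(x)` (see `smul_app`). -/
instance instLinear : Linear ℂ X.Modules := Linear.ofRingMorphism (toCatCenter X)

variable {X} in
lemma smul_app {M N : X.Modules} (a : ℂ) (f : M ⟶ N) (U : X.Opens) (x : Γ(M, U)) :
    (a • f).app U x = scalar X U a • f.app U x :=
  (Scheme.Modules.Hom.app_smul f (scalar X U a) x)

variable {X} {Y : Scheme.{0}} [Y.Over SpecC] (f : X ⟶ Y) [f.IsOver SpecC]

lemma app_scalar (U : Y.Opens) (a : ℂ) : f.app U (scalar Y U a) = scalar X (f ⁻¹ᵁ U) a := by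
  have h : f ≫ Y ↘ SpecC = X ↘ SpecC := comp_over f SpecC
  have : ((Scheme.ΓSpecIso (.of ℂ)).inv ≫ (Y ↘ SpecC).appTop ≫
      Y.presheaf.map (homOfLE (le_top : U ≤ ⊤)).op) ≫ f.app U = (Scheme.ΓSpecIso (.of ℂ)).inv ≫
      (X ↘ SpecC).appTop ≫ X.presheaf.map (homOfLE (le_top : f ⁻¹ᵁ U ≤ ⊤)).op := by
    rw [← h]
    simp only [Category.assoc, Scheme.Hom.comp_appTop, Scheme.Hom.naturality]
    rfl
  rw [scalar, scalar, ← this]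
  rfl

instance : (Scheme.Modules.pushforward f).Linear ℂ where
  map_smul {M N} φ a := by
    ext U x
    rw [smul_app]
    refine (smul_app a φ (f ⁻¹ᵁ U) x).trans ?_
    rw [← app_scalar f U a]
    rfl

lemma linear_of_adjunction {C D : Type*} [Category C] [Category D] [Preadditive C] [Preadditive D]
    [Linear ℂ C] [Linear ℂ D] {F : C ⥤ D} {G : D ⥤ C} (adj : F ⊣ G) [G.Linear ℂ] :
    F.Linear ℂ where
  map_smul {A B} φ a := by
    apply (adj.homEquiv _ _).injective
    have h : ∀ ψ : A ⟶ B, adj.homEquiv _ _ (F.map ψ) = ψ ≫ adj.unit.app B := fun ψ => by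
      rw [Adjunction.homEquiv_unit, adj.unit_naturality]
    rw [h, Linear.smul_comp, ← h, Adjunction.homEquiv_unit, Adjunction.homEquiv_unit,
      Functor.map_smul, Linear.comp_smul]

instance : (Scheme.Modules.pullback f).Linear ℂ :=
  linear_of_adjunction (Scheme.Modules.pullbackPushforwardAdjunction f)

end Linear

section MapDerived
variable {C₁ C₂ C₃ : Type*} [Category C₁] [Category C₂] [Category C₃] [Abelian C₁]
  [Abelian C₂] [Abelian C₃] [HasDerivedCategory C₁] [HasDerivedCategory C₂]
  [HasDerivedCategory C₃]

/-- A natural isomorphism of exact functors induces one on derived categories. -/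
def derivedMapIso {F F' : C₁ ⥤ C₂} [F.Additive] [PreservesFiniteLimits F]
    [PreservesFiniteColimits F] [F'.Additive] [PreservesFiniteLimits F']
    [PreservesFiniteColimits F'] (e : F ≅ F') : F.mapDerivedCategory ≅ F'.mapDerivedCategory :=
  Localization.liftNatIso DerivedCategory.Q (HomologicalComplex.quasiIso C₁ (.up ℤ))
    (F.mapHomologicalComplex (.up ℤ) ⋙ DerivedCategory.Q)
    (F'.mapHomologicalComplex (.up ℤ) ⋙ DerivedCategory.Q) _ _
    (Functor.isoWhiskerRight (NatIso.mapHomologicalComplex e (.up ℤ)) DerivedCategory.Q)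

/-- The composite of two derived exact functors is computed termwise on complexes. -/
def derivedMapCompFactors (F : C₁ ⥤ C₂) (F' : C₂ ⥤ C₃) [F.Additive] [PreservesFiniteLimits F]
    [PreservesFiniteColimits F] [F'.Additive] [PreservesFiniteLimits F']
    [PreservesFiniteColimits F'] :
    DerivedCategory.Q ⋙ (F.mapDerivedCategory ⋙ F'.mapDerivedCategory) ≅
      (F.mapHomologicalComplex (.up ℤ) ⋙ F'.mapHomologicalComplex (.up ℤ)) ⋙ DerivedCategory.Q :=
  (Functor.associator _ _ _).symm ≪≫
    Functor.isoWhiskerRight F.mapDerivedCategoryFactors F'.mapDerivedCategory ≪≫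
    Functor.associator _ _ _ ≪≫
    Functor.isoWhiskerLeft (F.mapHomologicalComplex (.up ℤ)) F'.mapDerivedCategoryFactors ≪≫
    (Functor.associator _ _ _).symm

/-- An isomorphism `F ⋙ F' ≅ H` of exact functors induces one on derived categories. -/
def derivedMapCompIso {F : C₁ ⥤ C₂} {F' : C₂ ⥤ C₃} {H : C₁ ⥤ C₃} [F.Additive]
    [PreservesFiniteLimits F] [PreservesFiniteColimits F] [F'.Additive]
    [PreservesFiniteLimits F'] [PreservesFiniteColimits F'] [H.Additive]
    [PreservesFiniteLimits H] [PreservesFiniteColimits H] (e : F ⋙ F' ≅ H) :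
    F.mapDerivedCategory ⋙ F'.mapDerivedCategory ≅ H.mapDerivedCategory :=
  letI : Localization.Lifting DerivedCategory.Q (HomologicalComplex.quasiIso C₁ (.up ℤ))
      ((F.mapHomologicalComplex (.up ℤ) ⋙ F'.mapHomologicalComplex (.up ℤ)) ⋙ DerivedCategory.Q)
      (F.mapDerivedCategory ⋙ F'.mapDerivedCategory) := ⟨derivedMapCompFactors F F'⟩
  Localization.liftNatIso DerivedCategory.Q (HomologicalComplex.quasiIso C₁ (.up ℤ))
    ((F.mapHomologicalComplex (.up ℤ) ⋙ F'.mapHomologicalComplex (.up ℤ)) ⋙ DerivedCategory.Q)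
    (H.mapHomologicalComplex (.up ℤ) ⋙ DerivedCategory.Q) _ _
    (Functor.isoWhiskerRight (Functor.mapHomologicalComplexCompIso e (.up ℤ)) DerivedCategory.Q)

/-- An isomorphism `F ≅ 𝟭` of exact functors induces one on derived categories. -/
def derivedMapIdIso {F : C₁ ⥤ C₁} [F.Additive] [PreservesFiniteLimits F]
    [PreservesFiniteColimits F] (e : F ≅ 𝟭 C₁) :
    F.mapDerivedCategory ≅ 𝟭 (DerivedCategory C₁) :=
  Localization.liftNatIso DerivedCategory.Q (HomologicalComplex.quasiIso C₁ (.up ℤ))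
    (F.mapHomologicalComplex (.up ℤ) ⋙ DerivedCategory.Q) DerivedCategory.Q _ _
    (Functor.isoWhiskerRight (NatIso.mapHomologicalComplex e (.up ℤ) ≪≫
      Functor.mapHomologicalComplexIdIso C₁ (.up ℤ)) DerivedCategory.Q ≪≫
      Functor.leftUnitor DerivedCategory.Q)
end MapDerived

section Derived
variable {X Y : Scheme.{0}}

/-- Pull-back along an isomorphism is an equivalence, hence exact. -/
instance (f : X ⟶ Y) [IsIso f] : (Scheme.Modules.pullback f).IsEquivalence := by
  let e : Y.Modules ≌ X.Modules := CategoryTheory.Equivalence.mk (Scheme.Modules.pullback f)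
    (Scheme.Modules.pullback (inv f))
    ((Scheme.Modules.pullbackId Y).symm ≪≫ Scheme.Modules.pullbackCongr (by simp) ≪≫
      (Scheme.Modules.pullbackComp (inv f) f).symm)
    (Scheme.Modules.pullbackComp f (inv f) ≪≫ Scheme.Modules.pullbackCongr (by simp) ≪≫
      (Scheme.Modules.pullbackId X))
  exact e.isEquivalence_functor

instance (X : Scheme.{0}) : HasDerivedCategory.{1} X.Modules := HasDerivedCategory.standard _

/-- The objects of `D^b(X)` inside the derived category of all `𝒪_X`-modules: bounded cohomology,
and all cohomology sheaves coherent (on a noetherian scheme, an `𝒪_X`-module is coherent if and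
only if it is locally of finite presentation). `D^b(X)` is the full subcategory on these objects,
so morphisms are those of the ambient derived category. -/
def IsBoundedCoherent (X : Scheme.{0}) : ObjectProperty (DerivedCategory X.Modules) := fun E =>
  DerivedCategory.TStructure.t.bounded E ∧
    ∀ n : ℤ, SheafOfModules.IsFinitePresentation
      ((DerivedCategory.homologyFunctor X.Modules n).obj E)

/-- `E` is simple: `Hom(E, E) = ℂ`. -/
def IsSimple [X.Over SpecC] (E : DerivedCategory X.Modules) : Prop :=
  Function.Bijective (fun a : ℂ => (a • 𝟙 E : E ⟶ E))
end Derived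

section Action
/- An action of `G` on `X` over `ℂ` is a homomorphism `ρ : G →* Aut (X.asOver SpecC)`. In `Aut`,
`g * h` is the composite `g ∘ h`, so this is a left action. -/
variable {G : Type} [Group G] {X : Scheme.{0}} [X.Over SpecC] (ρ : G →* Aut (X.asOver SpecC))

/-- The automorphism of `X` by which `g` acts. -/
def act (g : G) : X ⟶ X := (Iso.hom (ρ g)).left

lemma act_mul (g h : G) : act ρ (g * h) = act ρ h ≫ act ρ g := by
  unfold act
  rw [map_mul]
  rfl

lemma act_one : act ρ 1 = 𝟙 X := by
  unfold act
  rw [map_one]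
  rfl

instance (g : G) : IsIso (act ρ g) :=
  ⟨act ρ g⁻¹, by rw [← act_mul, inv_mul_cancel, act_one],
    by rw [← act_mul, mul_inv_cancel, act_one]⟩

instance (g : G) : (act ρ g).IsOver SpecC := ⟨Over.w (Iso.hom (ρ g))⟩

/-- The pull-back functor `g^*` on the derived category (`g` is an automorphism, so the underived
pull-back is exact). -/
def gPullback (g : G) : DerivedCategory X.Modules ⥤ DerivedCategory X.Modules :=
  (Scheme.Modules.pullback (act ρ g)).mapDerivedCategory

instance (g : G) : (gPullback ρ g).Linear ℂ := by
  unfold gPullback; infer_instance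

/-- The canonical isomorphism `h^* g^* ≅ (gh)^*`. -/
def gPullbackMul (g h : G) : gPullback ρ g ⋙ gPullback ρ h ≅ gPullback ρ (g * h) :=
  derivedMapCompIso (Scheme.Modules.pullbackComp (act ρ h) (act ρ g) ≪≫
    Scheme.Modules.pullbackCongr (act_mul ρ g h).symm)

/-- The canonical isomorphism `1^* ≅ id`. -/
def gPullbackOne : gPullback ρ 1 ≅ 𝟭 (DerivedCategory X.Modules) :=
  derivedMapIdIso (Scheme.Modules.pullbackCongr (act_one ρ) ≪≫ Scheme.Modules.pullbackId X)

/-- `E` is `G`-invariant: it is fixed, up to isomorphism, by all pull-backs `g^*`. -/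
def IsInvariant (E : DerivedCategory X.Modules) : Prop :=
  ∀ g : G, Nonempty (E ≅ (gPullback ρ g).obj E)

/-- A `G`-linearisation of `E`: isomorphisms `λ_g : E ≅ g^* E` with `λ_1 = id` and
`λ_{gh} = h^* λ_g ∘ λ_h`. -/
@[ext]
structure Linearisation (E : DerivedCategory X.Modules) where
  iso (g : G) : E ≅ (gPullback ρ g).obj E
  iso_one : (iso 1).hom ≫ (gPullbackOne ρ).hom.app E = 𝟙 E
  iso_mul (g h : G) : (iso (g * h)).hom =
    (iso h).hom ≫ (gPullback ρ h).map (iso g).hom ≫ (gPullbackMul ρ g h).hom.app E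

/-- The isomorphism `a • e`, for `a ∈ ℂ*`. -/
def smulIso {E F : DerivedCategory X.Modules} (a : ℂˣ) (e : E ≅ F) : E ≅ F where
  hom := (a : ℂ) • e.hom
  inv := ((a⁻¹ : ℂˣ) : ℂ) • e.inv
  hom_inv_id := by simp [smul_smul]
  inv_hom_id := by simp [smul_smul]

variable {ρ} {E : DerivedCategory X.Modules}

/-- Characters act on linearisations by `(χ • λ)_g = χ(g) λ_g`. -/
instance : MulAction (G →* ℂˣ) (Linearisation ρ E) where
  smul χ l :=
    { iso := fun g => smulIso (χ g) (l.iso g)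
      iso_one := by simp [smulIso, l.iso_one]
      iso_mul := fun g h => by
        simp only [smulIso, l.iso_mul g h, map_mul, Units.val_mul, Functor.map_smul,
          Linear.smul_comp, Linear.comp_smul, smul_smul] }
  one_smul l := by
    ext g
    change ((1 : ℂˣ) : ℂ) • (l.iso g).hom = (l.iso g).hom
    simp
  mul_smul χ ψ l := by
    ext g
    change ((χ g * ψ g : ℂˣ) : ℂ) • (l.iso g).hom = (χ g : ℂ) • (ψ g : ℂ) • (l.iso g).hom
    rw [Units.val_mul, smul_smul]

lemma smul_iso_hom (χ : G →* ℂˣ) (l : Linearisation ρ E) (g : G) :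
    ((χ • l).iso g).hom = (χ g : ℂ) • (l.iso g).hom := rfl

variable (ρ E) in
/-- Two linearisations of `E` are isomorphic if there is a `G`-invariant isomorphism
`f : (E, λ) ≅ (E, λ')`, that is `g^* f ∘ λ_g = λ'_g ∘ f` for all `g`. -/
def linearisationSetoid : Setoid (Linearisation ρ E) where
  r l l' := ∃ f : E ≅ E, ∀ g, (l.iso g).hom ≫ (gPullback ρ g).map f.hom = f.hom ≫ (l'.iso g).hom
  iseqv :=
    { refl := fun l => ⟨Iso.refl E, fun g => by simp⟩
      symm := fun {l l'} ⟨f, hf⟩ => ⟨f.symm, fun g => by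
        rw [Iso.symm_hom, Iso.eq_inv_comp, ← Category.assoc, ← hf, Category.assoc,
          ← Functor.map_comp, Iso.hom_inv_id, CategoryTheory.Functor.map_id, Category.comp_id]⟩
      trans := fun {l l' l''} ⟨f, hf⟩ ⟨f', hf'⟩ => ⟨f ≪≫ f', fun g => by
        rw [Iso.trans_hom, Functor.map_comp, ← Category.assoc, hf, Category.assoc, hf',
          Category.assoc]⟩ }

variable (ρ E) in
/-- The set of isomorphism classes of `G`-linearisations of `E`. -/
def LinearisationClasses : Type 1 := Quotient (linearisationSetoid ρ E)

/-- The action `(χ • λ)_g = χ(g) λ_g` of characters on isomorphism classes of linearisations. -/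
instance : MulAction (G →* ℂˣ) (LinearisationClasses ρ E) where
  smul χ := Quotient.map (χ • ·) (fun l l' ⟨f, hf⟩ => ⟨f, fun g => by
    rw [smul_iso_hom, smul_iso_hom, Linear.smul_comp, Linear.comp_smul, hf]⟩)
  one_smul := by
    rintro ⟨l⟩
    exact congrArg (Quotient.mk _) (one_smul _ l)
  mul_smul χ ψ := by
    rintro ⟨l⟩
    exact congrArg (Quotient.mk _) (mul_smul χ ψ l)

variable (G) in
/-- `ℂ*` with the trivial action of `G` (written additively). -/
abbrev unitsRep : Rep ℤ G := Rep.trivial ℤ G (Additive ℂˣ)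

variable (ρ E) in
/-- `ε` is the class of `E` in `H^2(G, ℂ*)`: for every choice of isomorphisms `μ_g : E ≅ g^* E`, the
units `c_{g,h}` defined by `μ_{gh} = c_{g,h} • (h^* μ_g ∘ μ_h)` form a `2`-cocycle of class `ε`. -/
def IsObstructionClass (ε : groupCohomology.H2 (unitsRep G)) : Prop :=
  ∀ μ : ∀ g, E ≅ (gPullback ρ g).obj E, ∃ c : groupCohomology.cocycles₂ (unitsRep G),
    groupCohomology.H2π (unitsRep G) c = ε ∧
    ∀ g h, (μ (g * h)).hom = ((Additive.toMul (c (g, h)) : ℂˣ) : ℂ) •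
      ((μ h).hom ≫ (gPullback ρ h).map (μ g).hom ≫ (gPullbackMul ρ g h).hom.app E)
end Action
end
end EquivariantSheaves

/-! Since `E` is simple, the isomorphisms from `E` to `g^* E` form a torsor under `ℂ*`
(`IsSimple.existsUnique_smulIso`). The product `h^* a ∘ b` of `a : E ≅ g^* E` and `b : E ≅ h^* E` is
associative (`pullbackTrans_assoc`) and, as `g^*` is `ℂ`-linear, bilinear in scalars
(`smulIso_pullbackTrans`). Morally this is a central extension of `G` by `ℂ*`, whose splittings are
the linearisations.

A choice of `μ` is a set-theoretic section, and its defect `c` is a cocycle by associativity.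
Rescaling `μ` by `b` changes `c` by the coboundary of `b`, so the class of `c` is independent of
`μ`; it vanishes iff some rescaling is multiplicative. Two linearisations differ by a function `G →
ℂ*`, which multiplicativity forces to be a character. Automorphisms of `E` are scalars and commute
with everything, so isomorphic linearisations are equal.

The technical work is the coherence of `h^* g^* ≅ (gh)^*` on the derived category, which is reduced
to complexes and then, degree by degree, to the pseudofunctor laws for modules. -/

namespace EquivariantSheaves
noncomputable section

/-! ### Coherence isomorphisms between derived exact functors. -/

section MapDerivedCoherence

variable {C₁ C₂ C₃ C₄ : Type*} [Category C₁] [Category C₂] [Category C₃] [Category C₄]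
  [Abelian C₁] [Abelian C₂] [Abelian C₃] [Abelian C₄] [HasDerivedCategory C₁]
  [HasDerivedCategory C₂] [HasDerivedCategory C₃] [HasDerivedCategory C₄]

lemma derivedMapIdIso_hom_app_Q {F : C₁ ⥤ C₁} [F.Additive] [PreservesFiniteLimits F]
    [PreservesFiniteColimits F] (e : F ≅ 𝟭 C₁) (K : CochainComplex C₁ ℤ) :
    (derivedMapIdIso e).hom.app (DerivedCategory.Q.obj K) =
      F.mapDerivedCategoryFactors.hom.app K ≫
        DerivedCategory.Q.map ((NatIso.mapHomologicalComplex e (.up ℤ) ≪≫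
          Functor.mapHomologicalComplexIdIso C₁ (.up ℤ)).hom.app K) := by
  refine (Localization.liftNatTrans_app _ _ _ _ _ _ _ _).trans ?_
  change F.mapDerivedCategoryFactors.hom.app K ≫ _ ≫ 𝟙 _ = _
  rw [Category.comp_id]
  congr 1
  change _ ≫ 𝟙 _ = _
  rw [Category.comp_id]
  rfl

lemma derivedMapCompIso_hom_app_Q {F : C₁ ⥤ C₂} {F' : C₂ ⥤ C₃} {H : C₁ ⥤ C₃} [F.Additive]
    [PreservesFiniteLimits F] [PreservesFiniteColimits F] [F'.Additive]
    [PreservesFiniteLimits F'] [PreservesFiniteColimits F'] [H.Additive]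
    [PreservesFiniteLimits H] [PreservesFiniteColimits H] (e : F ⋙ F' ≅ H)
    (K : CochainComplex C₁ ℤ) :
    (derivedMapCompIso e).hom.app (DerivedCategory.Q.obj K) =
      F'.mapDerivedCategory.map (F.mapDerivedCategoryFactors.hom.app K) ≫
        F'.mapDerivedCategoryFactors.hom.app ((F.mapHomologicalComplex (.up ℤ)).obj K) ≫
        DerivedCategory.Q.map ((Functor.mapHomologicalComplexCompIso e (.up ℤ)).hom.app K) ≫
        H.mapDerivedCategoryFactors.inv.app K := by
  let : Localization.Lifting DerivedCategory.Q (HomologicalComplex.quasiIso C₁ (.up ℤ))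
      ((F.mapHomologicalComplex (.up ℤ) ⋙ F'.mapHomologicalComplex (.up ℤ)) ⋙ DerivedCategory.Q)
      (F.mapDerivedCategory ⋙ F'.mapDerivedCategory) := ⟨derivedMapCompFactors F F'⟩
  have h : (derivedMapCompFactors F F').hom.app K =
      F'.mapDerivedCategory.map (F.mapDerivedCategoryFactors.hom.app K) ≫
        F'.mapDerivedCategoryFactors.hom.app ((F.mapHomologicalComplex (.up ℤ)).obj K) := by
    change 𝟙 _ ≫ _ ≫ 𝟙 _ ≫ _ ≫ 𝟙 _ = _
    rw [Category.id_comp, Category.id_comp, Category.comp_id]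
    rfl
  refine (Localization.liftNatTrans_app _ _ _ _ _ _ _ _).trans ?_
  change (derivedMapCompFactors F F').hom.app K ≫ _ = _
  rw [h, Category.assoc]
  rfl

/-- A unit constraint between exact functors passes to derived categories. -/
lemma derivedMapCompIso_hom_app_of_unit {F : C₁ ⥤ C₂} {U : C₂ ⥤ C₂} [F.Additive]
    [PreservesFiniteLimits F] [PreservesFiniteColimits F] [U.Additive]
    [PreservesFiniteLimits U] [PreservesFiniteColimits U] (e : F ⋙ U ≅ F) (u : U ≅ 𝟭 C₂)
    (h : ∀ M, e.hom.app M = u.hom.app (F.obj M)) (E : DerivedCategory C₁) :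
    (derivedMapCompIso e).hom.app E =
      (derivedMapIdIso u).hom.app (F.mapDerivedCategory.obj E) := by
  -- As an equality of natural transformations, this can be tested on the objects `Q K`.
  suffices (derivedMapCompIso e).hom =
      Functor.whiskerLeft F.mapDerivedCategory (derivedMapIdIso u).hom from
    congr_app this E
  refine Localization.natTrans_ext DerivedCategory.Q (HomologicalComplex.quasiIso C₁ (.up ℤ))
    fun K => ?_
  rw [derivedMapCompIso_hom_app_Q, Functor.whiskerLeft_app]
  -- Naturality moves the unit constraint to `Q` of the complex `F K`, where its explicit formula
  -- applies.
  have n := (derivedMapIdIso u).hom.naturality (F.mapDerivedCategoryFactors.hom.app K)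
  have q := derivedMapIdIso_hom_app_Q u ((F.mapHomologicalComplex (.up ℤ)).obj K)
  have hK : (Functor.mapHomologicalComplexCompIso e (.up ℤ)).hom.app K =
      (NatIso.mapHomologicalComplex u (.up ℤ) ≪≫
        Functor.mapHomologicalComplexIdIso C₂ (.up ℤ)).hom.app
          ((F.mapHomologicalComplex (.up ℤ)).obj K) := by
    ext i
    refine (h (K.X i)).trans ?_
    exact (Category.comp_id _).symm
  rw [hK]
  have n' := (n =≫ F.mapDerivedCategoryFactors.inv.app K)
  erw [q] at n'
  simp only [Category.assoc] at n' ⊢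
  refine n'.trans ?_
  change (derivedMapIdIso u).hom.app _ ≫ F.mapDerivedCategoryFactors.hom.app K ≫ _ = _
  rw [Iso.hom_inv_id_app]
  exact Category.comp_id _

/-- The diagram chase behind `derivedMapCompIso_hom_app_assoc`. There `hc` and `hw` are naturality
squares, `hc'` is the formula on `Q`, `hr` and `hs` cancel factorisations, and `hq` is the identity
on complexes. With free objects the rewrites do not depend on how composite functors unfold. -/
lemma comp_eq_of_factorizations {C : Type*} [Category C] {A₀ A₁ A₂ A₃ A₄ A₅ A₆ B₀ B₁ B₂ B₃ Z : C}
    {c : A₀ ⟶ B₀} {p : B₀ ⟶ B₁} {r : B₁ ⟶ B₂} {a : B₂ ⟶ B₃} {t : B₃ ⟶ Z} {x : A₀ ⟶ A₁}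
    {c' : A₁ ⟶ B₁} {y : A₁ ⟶ A₂} {z : A₂ ⟶ A₃} {q : A₃ ⟶ B₂} {r' : B₂ ⟶ B₁} {w : A₂ ⟶ A₄}
    {s' : A₄ ⟶ A₅} {s : A₅ ⟶ A₄} {v : A₄ ⟶ A₆} {b : A₆ ⟶ B₃} {w' : A₃ ⟶ A₆}
    (hc : c ≫ p = x ≫ c') (hc' : c' = y ≫ z ≫ q ≫ r') (hr : r' ≫ r = 𝟙 _) (hs : s' ≫ s = 𝟙 _)
    (hw : w ≫ v = z ≫ w') (hq : q ≫ a = w' ≫ b) :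
    c ≫ p ≫ r ≫ a ≫ t = x ≫ y ≫ w ≫ s' ≫ s ≫ v ≫ b ≫ t := by
  rw [reassoc_of% hc, hc', reassoc_of% hs, reassoc_of% hw]
  simp only [Category.assoc]
  rw [reassoc_of% hr, reassoc_of% hq]

/-- An associativity constraint between exact functors passes to derived categories. -/
lemma derivedMapCompIso_hom_app_assoc {F₁ : C₁ ⥤ C₂} {F₂ : C₂ ⥤ C₃} {F₃ : C₃ ⥤ C₄}
    {F₁₂ : C₁ ⥤ C₃} {F₂₃ : C₂ ⥤ C₄} {H : C₁ ⥤ C₄}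
    [F₁.Additive] [PreservesFiniteLimits F₁] [PreservesFiniteColimits F₁]
    [F₂.Additive] [PreservesFiniteLimits F₂] [PreservesFiniteColimits F₂]
    [F₃.Additive] [PreservesFiniteLimits F₃] [PreservesFiniteColimits F₃]
    [F₁₂.Additive] [PreservesFiniteLimits F₁₂] [PreservesFiniteColimits F₁₂]
    [F₂₃.Additive] [PreservesFiniteLimits F₂₃] [PreservesFiniteColimits F₂₃]
    [H.Additive] [PreservesFiniteLimits H] [PreservesFiniteColimits H]
    (e₁₂ : F₁ ⋙ F₂ ≅ F₁₂) (e₂₃ : F₂ ⋙ F₃ ≅ F₂₃) (a : F₁ ⋙ F₂₃ ≅ H) (b : F₁₂ ⋙ F₃ ≅ H)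
    (h : ∀ M, e₂₃.hom.app (F₁.obj M) ≫ a.hom.app M = F₃.map (e₁₂.hom.app M) ≫ b.hom.app M)
    (E : DerivedCategory C₁) :
    (derivedMapCompIso e₂₃).hom.app (F₁.mapDerivedCategory.obj E) ≫
        (derivedMapCompIso a).hom.app E =
      F₃.mapDerivedCategory.map ((derivedMapCompIso e₁₂).hom.app E) ≫
        (derivedMapCompIso b).hom.app E := by
  suffices (Functor.associator F₁.mapDerivedCategory F₂.mapDerivedCategory
        F₃.mapDerivedCategory).hom ≫
      Functor.whiskerLeft F₁.mapDerivedCategory (derivedMapCompIso e₂₃).hom ≫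
        (derivedMapCompIso a).hom =
      Functor.whiskerRight (derivedMapCompIso e₁₂).hom F₃.mapDerivedCategory ≫
        (derivedMapCompIso b).hom from
    (Category.id_comp _).symm.trans (congr_app this E)
  refine Localization.natTrans_ext DerivedCategory.Q (HomologicalComplex.quasiIso C₁ (.up ℤ))
    fun K => ?_
  refine (Category.id_comp _).trans ?_
  change (derivedMapCompIso e₂₃).hom.app (F₁.mapDerivedCategory.obj (DerivedCategory.Q.obj K)) ≫
    (derivedMapCompIso a).hom.app (DerivedCategory.Q.obj K) =
      F₃.mapDerivedCategory.map ((derivedMapCompIso e₁₂).hom.app (DerivedCategory.Q.obj K)) ≫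
        (derivedMapCompIso b).hom.app (DerivedCategory.Q.obj K)
  rw [derivedMapCompIso_hom_app_Q, derivedMapCompIso_hom_app_Q, derivedMapCompIso_hom_app_Q]
  have n := (derivedMapCompIso e₂₃).hom.naturality (F₁.mapDerivedCategoryFactors.hom.app K)
  have q := derivedMapCompIso_hom_app_Q e₂₃ ((F₁.mapHomologicalComplex (.up ℤ)).obj K)
  have hK : (Functor.mapHomologicalComplexCompIso e₂₃ (.up ℤ)).hom.app
        ((F₁.mapHomologicalComplex (.up ℤ)).obj K) ≫
      (Functor.mapHomologicalComplexCompIso a (.up ℤ)).hom.app K =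
      (F₃.mapHomologicalComplex (.up ℤ)).map
        ((Functor.mapHomologicalComplexCompIso e₁₂ (.up ℤ)).hom.app K) ≫
      (Functor.mapHomologicalComplexCompIso b (.up ℤ)).hom.app K := by
    ext i
    exact h (K.X i)
  have hQ := congrArg (DerivedCategory.Q (C := C₄)).map hK
  rw [Functor.map_comp, Functor.map_comp] at hQ
  have n₃ := F₃.mapDerivedCategoryFactors_hom_naturality
    ((Functor.mapHomologicalComplexCompIso e₁₂ (.up ℤ)).hom.app K)
  have r : F₂₃.mapDerivedCategoryFactors.inv.app ((F₁.mapHomologicalComplex (.up ℤ)).obj K) ≫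
      F₂₃.mapDerivedCategoryFactors.hom.app ((F₁.mapHomologicalComplex (.up ℤ)).obj K) = 𝟙 _ :=
    Iso.inv_hom_id_app _ _
  have s : F₃.mapDerivedCategory.map (F₁₂.mapDerivedCategoryFactors.inv.app K) ≫
      F₃.mapDerivedCategory.map (F₁₂.mapDerivedCategoryFactors.hom.app K) = 𝟙 _ := by
    rw [← Functor.map_comp, Iso.inv_hom_id_app]
    exact CategoryTheory.Functor.map_id _ _
  simp only [Functor.map_comp, Category.assoc]
  exact comp_eq_of_factorizations n.symm q r s n₃ hQ

end MapDerivedCoherence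

/-! ### Coherence of pull-backs of modules. -/

section PullbackCoherence

variable {X Y Z T : Scheme.{0}}

/-- The isomorphism `f^* g^* ≅ k^*` for `k = f ≫ g`. -/
def pullbackCompOfEq (f : X ⟶ Y) (g : Y ⟶ Z) (k : X ⟶ Z) (hk : f ≫ g = k) :
    Scheme.Modules.pullback g ⋙ Scheme.Modules.pullback f ≅ Scheme.Modules.pullback k :=
  Scheme.Modules.pullbackComp f g ≪≫ Scheme.Modules.pullbackCongr hk

lemma pullbackCompOfEq_assoc (f : X ⟶ Y) (g : Y ⟶ Z) (h : Z ⟶ T) {fg : X ⟶ Z} {gh : Y ⟶ T}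
    {k : X ⟶ T} (hfg : f ≫ g = fg) (hgh : g ≫ h = gh) (hk : fg ≫ h = k) (hk' : f ≫ gh = k)
    (M : T.Modules) :
    (pullbackCompOfEq f g fg hfg).hom.app ((Scheme.Modules.pullback h).obj M) ≫
        (pullbackCompOfEq fg h k hk).hom.app M =
      (Scheme.Modules.pullback f).map ((pullbackCompOfEq g h gh hgh).hom.app M) ≫
        (pullbackCompOfEq f gh k hk').hom.app M := by
  subst hfg hgh hk
  have H := congr_app (Scheme.Modules.pseudofunctor_associativity f g h) M
  simp only [NatTrans.comp_app, Functor.whiskerRight_app, Functor.whiskerLeft_app,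
    Functor.associator_hom_app, eqToHom_app] at H
  have h₁ := (Scheme.Modules.pullbackComp f (g ≫ h)).hom_inv_id_app M
  have h₂ : (Scheme.Modules.pullback f).map ((Scheme.Modules.pullbackComp g h).hom.app M) ≫
      (Scheme.Modules.pullback f).map ((Scheme.Modules.pullbackComp g h).inv.app M) = 𝟙 _ := by
    rw [← Functor.map_comp, Iso.hom_inv_id_app, CategoryTheory.Functor.map_id]
  simp only [pullbackCompOfEq, Scheme.Modules.pullbackCongr, eqToIso_refl, Iso.trans_refl,
    Iso.trans_hom, NatTrans.comp_app, eqToIso.hom, eqToHom_app]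
  -- The only remaining `eqToHom` compares the two bracketings of `f ≫ g ≫ h`; the pseudofunctor law
  -- expands it, and the inverses so introduced cancel.
  rw [← H, reassoc_of% h₁, reassoc_of% h₂]
  exact (Category.id_comp _).symm

lemma pullbackCompOfEq_unit {f : X ⟶ X} (hf : f = 𝟙 X) (g : X ⟶ Z) (hk : f ≫ g = g)
    (M : Z.Modules) :
    (pullbackCompOfEq f g g hk).hom.app M =
      (Scheme.Modules.pullbackCongr hf ≪≫ Scheme.Modules.pullbackId X).hom.app
        ((Scheme.Modules.pullback g).obj M) := by
  subst hf
  have H := congr_app (Scheme.Modules.pseudofunctor_right_unitality g) M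
  simp only [NatTrans.comp_app, Functor.whiskerLeft_app, Functor.rightUnitor_hom_app,
    eqToHom_app] at H
  have h₁ := (Scheme.Modules.pullbackComp (𝟙 X) g).hom_inv_id_app M
  simp only [pullbackCompOfEq, Scheme.Modules.pullbackCongr, eqToIso_refl, Iso.refl_trans,
    Iso.trans_hom, NatTrans.comp_app, eqToIso.hom, eqToHom_app]
  rw [← H, reassoc_of% h₁]
  exact Category.comp_id _

end PullbackCoherence

/-! ### The associative product of isomorphisms `E ≅ g^* E`. -/

section Composition

variable {G : Type} [Group G] {X : Scheme.{0}} [X.Over SpecC] (ρ : G →* Aut (X.asOver SpecC))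

/-- The canonical isomorphism `h^* g^* ≅ s^*` for `s = gh`. -/
def gPullbackMulOfEq (g h s : G) (hs : g * h = s) :
    gPullback ρ g ⋙ gPullback ρ h ≅ gPullback ρ s :=
  derivedMapCompIso (pullbackCompOfEq (act ρ h) (act ρ g) (act ρ s) (by rw [← hs, act_mul]))

lemma gPullbackMulOfEq_assoc (g h k : G) {gh hk s : G} (hgh : g * h = gh) (hhk : h * k = hk)
    (hs : gh * k = s) (hs' : g * hk = s) (E : DerivedCategory X.Modules) :
    (gPullbackMulOfEq ρ h k hk hhk).hom.app ((gPullback ρ g).obj E) ≫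
        (gPullbackMulOfEq ρ g hk s hs').hom.app E =
      (gPullback ρ k).map ((gPullbackMulOfEq ρ g h gh hgh).hom.app E) ≫
        (gPullbackMulOfEq ρ gh k s hs).hom.app E :=
  derivedMapCompIso_hom_app_assoc _ _ _ _ (pullbackCompOfEq_assoc _ _ _ _ _ _ _) E

lemma gPullbackMulOfEq_one (g : G) (E : DerivedCategory X.Modules) :
    (gPullbackMulOfEq ρ g 1 g (mul_one g)).hom.app E =
      (gPullbackOne ρ).hom.app ((gPullback ρ g).obj E) :=
  derivedMapCompIso_hom_app_of_unit _ _ (pullbackCompOfEq_unit (act_one ρ) _ _) E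

variable {ρ} {E : DerivedCategory X.Modules}

/-- The composite `h^* a ∘ b` of `a : E ≅ g^* E` and `b : E ≅ h^* E`, as an isomorphism onto
`s^* E` for `s = gh`. -/
def pullbackTrans {g h s : G} (hs : g * h = s) (a : E ≅ (gPullback ρ g).obj E)
    (b : E ≅ (gPullback ρ h).obj E) : E ≅ (gPullback ρ s).obj E :=
  b ≪≫ (gPullback ρ h).mapIso a ≪≫ (gPullbackMulOfEq ρ g h s hs).app E

lemma pullbackTrans_hom {g h s : G} (hs : g * h = s) (a : E ≅ (gPullback ρ g).obj E)
    (b : E ≅ (gPullback ρ h).obj E) : (pullbackTrans hs a b).hom =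
      b.hom ≫ (gPullback ρ h).map a.hom ≫ (gPullbackMulOfEq ρ g h s hs).hom.app E := rfl

/-- Associativity of the constraints together with naturality of `k^* h^* ≅ (hk)^*` at `a`. The
target index is a variable because `(gh)k` and `g(hk)` are only propositionally equal. -/
lemma pullbackTrans_assoc {g h k gh hk s : G} (hgh : g * h = gh) (hhk : h * k = hk)
    (hs : gh * k = s) (hs' : g * hk = s) (a : E ≅ (gPullback ρ g).obj E)
    (b : E ≅ (gPullback ρ h).obj E) (c : E ≅ (gPullback ρ k).obj E) :
    pullbackTrans hs (pullbackTrans hgh a b) c = pullbackTrans hs' a (pullbackTrans hhk b c) := by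
  ext
  simp only [pullbackTrans_hom, Functor.map_comp, Category.assoc]
  rw [← gPullbackMulOfEq_assoc ρ g h k hgh hhk hs hs' E]
  have n := (gPullbackMulOfEq ρ h k hk hhk).hom.naturality a.hom
  rw [← reassoc_of% n]

lemma smulIso_pullbackTrans {g h s : G} (hs : g * h = s) (x y : ℂˣ)
    (a : E ≅ (gPullback ρ g).obj E) (b : E ≅ (gPullback ρ h).obj E) :
    pullbackTrans hs (smulIso x a) (smulIso y b) = smulIso (x * y) (pullbackTrans hs a b) := by
  ext
  simp only [pullbackTrans_hom, smulIso, Functor.map_smul, Linear.smul_comp, Linear.comp_smul,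
    smul_smul, Units.val_mul]

lemma smulIso_smulIso {E F : DerivedCategory X.Modules} (x y : ℂˣ) (e : E ≅ F) :
    smulIso x (smulIso y e) = smulIso (x * y) e := by
  ext
  simp [smulIso, smul_smul]

lemma smulIso_one {E F : DerivedCategory X.Modules} (e : E ≅ F) : smulIso 1 e = e := by
  ext
  simp [smulIso]

/-- The isomorphisms out of a simple object form a torsor under `ℂ*`. -/
lemma IsSimple.existsUnique_smulIso (hE : IsSimple E) {F : DerivedCategory X.Modules}
    (e e' : E ≅ F) : ∃! a : ℂˣ, e' = smulIso a e := by
  obtain ⟨a, ha⟩ := hE.2 (e'.hom ≫ e.inv)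
  -- The opposite ratio, needed only to see that `a` is a unit.
  obtain ⟨b, hb⟩ := hE.2 (e.hom ≫ e'.inv)
  have ha' : a • 𝟙 E = e'.hom ≫ e.inv := ha
  have hb' : b • 𝟙 E = e.hom ≫ e'.inv := hb
  have hab : a * b = 1 := hE.1 <| by
    change (a * b) • 𝟙 E = (1 : ℂ) • 𝟙 E
    have : (a • 𝟙 E) ≫ (b • 𝟙 E) = 𝟙 E := by rw [ha', hb']; simp
    simpa [smul_smul, mul_comm] using this
  refine ⟨⟨a, b, hab, by rw [mul_comm, hab]⟩, ?_, fun c hc => Units.ext (hE.1 ?_)⟩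
  · ext
    change e'.hom = a • e.hom
    rw [← Category.id_comp e.hom, ← Linear.smul_comp, ha']
    simp
  · change (c : ℂ) • 𝟙 E = a • 𝟙 E
    rw [ha', hc]
    simp [smulIso]

lemma IsSimple.smulIso_injective (hE : IsSimple E) {F : DerivedCategory X.Modules} (e : E ≅ F)
    {a b : ℂˣ} (h : smulIso a e = smulIso b e) : a = b :=
  (hE.existsUnique_smulIso e (smulIso a e)).unique rfl h

lemma Linearisation.iso_eq_pullbackTrans (l : Linearisation ρ E) (g h : G) :
    l.iso (g * h) = pullbackTrans rfl (l.iso g) (l.iso h) := by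
  ext
  exact l.iso_mul g h

/-- The unit condition of a linearisation follows from the cocycle condition. -/
def Linearisation.ofPullbackTrans (l : ∀ g, E ≅ (gPullback ρ g).obj E)
    (hl : ∀ g h, l (g * h) = pullbackTrans rfl (l g) (l h)) : Linearisation ρ E where
  iso := l
  iso_one := by
    have h : ∀ s (hs : (1 : G) * 1 = s), l s = pullbackTrans hs (l 1) (l 1) := by
      rintro _ rfl
      exact hl 1 1
    -- In the product, `l 1` is idempotent: by naturality of the unit constraint, `l 1` equals `l 1`
    -- followed by that constraint and by `l 1` again. Cancelling the last isomorphism gives the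
    -- unit condition.
    have h₁ := congrArg Iso.hom (h 1 (mul_one 1))
    rw [pullbackTrans_hom, gPullbackMulOfEq_one] at h₁
    have n := (gPullbackOne ρ).hom.naturality (l 1).hom
    rw [n] at h₁
    rw [← cancel_mono (l 1).hom, Category.id_comp, Category.assoc]
    exact h₁.symm
  iso_mul g h := congrArg Iso.hom (hl g h)

end Composition

/-! ### The obstruction class and the torsor of linearisations. -/

section Obstruction

variable {G : Type} [Group G] {X : Scheme.{0}} [X.Over SpecC] {ρ : G →* Aut (X.asOver SpecC)}
  {E : DerivedCategory X.Modules}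

lemma mem_coboundaries₂_unitsRep_iff (f : G × G → unitsRep G) :
    f ∈ groupCohomology.coboundaries₂ (unitsRep G) ↔
      ∃ b : G → ℂˣ, ∀ g h, Additive.toMul (f (g, h)) = b h / b (g * h) * b g := by
  constructor
  · rintro ⟨b, rfl⟩
    exact ⟨fun g => Additive.toMul (b g), fun g h => rfl⟩
  · rintro ⟨b, hb⟩
    exact ⟨fun g => Additive.ofMul (b g), funext fun x => (hb x.1 x.2).symm⟩

/-- `c` is the cochain with `μ_{gh} = c_{g,h} • (h^* μ_g ∘ μ_h)`. -/
def IsDefect (μ : ∀ g, E ≅ (gPullback ρ g).obj E) (c : G → G → ℂˣ) : Prop :=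
  ∀ g h, μ (g * h) = smulIso (c g h) (pullbackTrans rfl (μ g) (μ h))

lemma IsSimple.exists_isDefect (hE : IsSimple E) (μ : ∀ g, E ≅ (gPullback ρ g).obj E) :
    ∃ c, IsDefect μ c := by
  choose c hc _ using fun g h =>
    hE.existsUnique_smulIso (pullbackTrans rfl (μ g) (μ h)) (μ (g * h))
  exact ⟨c, hc⟩

lemma IsDefect.unique (hE : IsSimple E) {μ : ∀ g, E ≅ (gPullback ρ g).obj E}
    {c c' : G → G → ℂˣ} (h : IsDefect μ c) (h' : IsDefect μ c') : c = c' := by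
  ext1 g
  ext1 k
  exact hE.smulIso_injective _ ((h g k).symm.trans (h' g k))

/-- Expand `μ_{ghk}` through both bracketings: the two products agree by associativity, so
simplicity lets their scalars be compared. -/
lemma IsDefect.isCocycle (hE : IsSimple E) {μ : ∀ g, E ≅ (gPullback ρ g).obj E}
    {c : G → G → ℂˣ} (hc : IsDefect μ c) (g h k : G) :
    c (g * h) k * c g h = c h k * c g (h * k) := by
  have key : ∀ {g h s : G} (hs : g * h = s),
      μ s = smulIso (c g h) (pullbackTrans hs (μ g) (μ h)) := by
    rintro g h _ rfl
    exact hc g h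
  have h₁ := key (mul_assoc g h k)
  -- The scalar `1` is inserted so that `smulIso_pullbackTrans` applies to both factors.
  have h₂ : μ (g * (h * k)) = smulIso (c g (h * k)) (pullbackTrans rfl (smulIso 1 (μ g))
      (smulIso (c h k) (pullbackTrans rfl (μ h) (μ k)))) := by
    rw [smulIso_one, ← hc h k]
    exact hc g (h * k)
  rw [key (rfl : g * h = g * h), ← smulIso_one (μ k), smulIso_pullbackTrans, mul_one,
    smulIso_smulIso, pullbackTrans_assoc rfl rfl _ rfl] at h₁
  rw [smulIso_pullbackTrans, one_mul, smulIso_smulIso] at h₂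
  rw [hE.smulIso_injective _ (h₁.symm.trans h₂), mul_comm]

/-- The left side acquires `b (g * h)` and the product acquires `b g * b h`; hence the defect is
divided by the coboundary of `b`. -/
lemma IsDefect.rescale {μ : ∀ g, E ≅ (gPullback ρ g).obj E} {c : G → G → ℂˣ}
    (hc : IsDefect μ c) (b : G → ℂˣ) :
    IsDefect (fun g => smulIso (b g) (μ g)) (fun g h => c g h * (b (g * h) / (b g * b h))) := by
  intro g h
  change smulIso (b (g * h)) (μ (g * h)) = _
  rw [smulIso_pullbackTrans, smulIso_smulIso, hc g h, smulIso_smulIso]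
  congr 1
  rw [mul_assoc, div_mul_cancel, mul_comm]

/-- The `2`-cocycle given by a choice of isomorphisms `E ≅ g^* E`. -/
def IsDefect.cocycle (hE : IsSimple E) {μ : ∀ g, E ≅ (gPullback ρ g).obj E}
    {c : G → G → ℂˣ} (hc : IsDefect μ c) : groupCohomology.cocycles₂ (unitsRep G) :=
  ⟨fun x => Additive.ofMul (c x.1 x.2), (groupCohomology.mem_cocycles₂_iff _).2 fun g h k =>
    congrArg Additive.ofMul (hc.isCocycle hE g h k)⟩

lemma IsDefect.H2π_cocycle_eq (hE : IsSimple E) {μ μ' : ∀ g, E ≅ (gPullback ρ g).obj E}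
    {c c' : G → G → ℂˣ} (hc : IsDefect μ c) (hc' : IsDefect μ' c') :
    groupCohomology.H2π (unitsRep G) (hc.cocycle hE) =
      groupCohomology.H2π (unitsRep G) (hc'.cocycle hE) := by
  choose b hb _ using fun g => hE.existsUnique_smulIso (μ g) (μ' g)
  obtain rfl : μ' = fun g => smulIso (b g) (μ g) := funext hb
  obtain rfl := hc'.unique hE (hc.rescale b)
  rw [groupCohomology.H2π_eq_iff, mem_coboundaries₂_unitsRep_iff]
  -- The difference is taken as old minus new, so the witness is `b` itself and not its inverse.
  refine ⟨b, fun g k => ?_⟩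
  have h (x p q r : ℂˣ) : x / (x * (r / (p * q))) = q / r * p := by
    rw [div_mul_cancel_left, inv_div, mul_comm p q, div_mul_eq_mul_div]
  exact h _ _ _ _

lemma IsDefect.H2π_cocycle_eq_zero_iff (hE : IsSimple E) {μ : ∀ g, E ≅ (gPullback ρ g).obj E}
    {c : G → G → ℂˣ} (hc : IsDefect μ c) :
    groupCohomology.H2π (unitsRep G) (hc.cocycle hE) = 0 ↔ Nonempty (Linearisation ρ E) := by
  constructor
  · intro h
    rw [groupCohomology.H2π_eq_zero_iff, mem_coboundaries₂_unitsRep_iff] at h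
    obtain ⟨b, hb⟩ := h
    -- When `c` is the coboundary of `b`, rescaling by the same `b` makes the defect trivial.
    refine ⟨.ofPullbackTrans (fun g => smulIso (b g) (μ g)) fun g h => ?_⟩
    have hgh : c g h = b h / b (g * h) * b g := hb g h
    have hl : c g h * (b (g * h) / (b g * b h)) = 1 := by
      rw [hgh, div_mul_eq_mul_div, mul_comm (b h), div_mul_div_cancel, div_self']
    refine (hc.rescale b g h).trans ?_
    dsimp only
    rw [hl, smulIso_one]
  · rintro ⟨l⟩
    have hl : IsDefect l.iso fun _ _ => 1 := fun g h => by
      rw [smulIso_one, l.iso_eq_pullbackTrans]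
    rw [hc.H2π_cocycle_eq hE hl, groupCohomology.H2π_eq_zero_iff, mem_coboundaries₂_unitsRep_iff]
    refine ⟨1, fun g h => ?_⟩
    change (1 : ℂˣ) = 1 / 1 * 1
    rw [div_one, mul_one]

/-- A single choice of `μ` decides the class: its defect is unique, and every other choice gives a
cohomologous cocycle. Existence and uniqueness of the obstruction class both follow. -/
lemma isObstructionClass_iff (hE : IsSimple E) {μ : ∀ g, E ≅ (gPullback ρ g).obj E}
    {c : G → G → ℂˣ} (hc : IsDefect μ c) (ε : groupCohomology.H2 (unitsRep G)) :
    IsObstructionClass ρ E ε ↔ ε = groupCohomology.H2π (unitsRep G) (hc.cocycle hE) := by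
  constructor
  · intro h
    obtain ⟨d, rfl, hd⟩ := h μ
    obtain rfl := hc.unique hE (c' := fun g h => Additive.toMul (d (g, h)))
      fun g h => Iso.ext (hd g h)
    rfl
  · rintro rfl μ'
    obtain ⟨c', hc'⟩ := hE.exists_isDefect μ'
    exact ⟨hc'.cocycle hE, hc'.H2π_cocycle_eq hE hc, fun g h => congrArg Iso.hom (hc' g h)⟩

/-- Automorphisms of a simple object do not identify distinct linearisations. -/
lemma IsSimple.eq_of_linearisationSetoid (hE : IsSimple E) {l l' : Linearisation ρ E}
    (h : (linearisationSetoid ρ E).r l l') : l = l' := by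
  obtain ⟨f, hf⟩ := h
  -- The automorphism is a scalar `a`; by linearity `g^*` sends it to the same scalar, which then
  -- cancels.
  obtain ⟨a, rfl, -⟩ := hE.existsUnique_smulIso (Iso.refl E) f
  ext g
  have := hf g
  simp only [smulIso, Iso.refl_hom, Functor.map_smul, CategoryTheory.Functor.map_id,
    Linear.comp_smul, Linear.smul_comp, Category.comp_id, Category.id_comp] at this
  simpa [smul_smul] using congrArg (((a⁻¹ : ℂˣ) : ℂ) • ·) this

/-- The ratio of `l'` to `l` is a unique function on `G`, multiplicative because both have trivial
defect. -/
lemma IsSimple.existsUnique_character_smul (hE : IsSimple E) (l l' : Linearisation ρ E) :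
    ∃! χ : G →* ℂˣ, χ • l = l' := by
  choose χ hχ hu using fun g => hE.existsUnique_smulIso (l.iso g) (l'.iso g)
  refine ⟨MonoidHom.mk' χ fun g h => ?_, ?_, fun ψ hψ => ?_⟩
  · refine hE.smulIso_injective (l.iso (g * h)) ?_
    rw [← hχ, l'.iso_eq_pullbackTrans, hχ g, hχ h, smulIso_pullbackTrans, l.iso_eq_pullbackTrans]
  · ext g
    exact (congrArg Iso.hom (hχ g)).symm
  · ext g : 1
    subst hψ
    exact hu g (ψ g) rfl

/-- Passing to classes identifies nothing, so simple transitivity descends from linearisations;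
injectivity is what uniqueness of `χ` needs. -/
lemma IsSimple.existsUnique_character_smul_class (hE : IsSimple E)
    (x y : LinearisationClasses ρ E) : ∃! χ : G →* ℂˣ, χ • x = y := by
  obtain ⟨l⟩ := x
  obtain ⟨l'⟩ := y
  obtain ⟨χ, hχ, hu⟩ := hE.existsUnique_character_smul l l'
  exact ⟨χ, congrArg (Quotient.mk _) hχ, fun ψ hψ =>
    hu ψ (hE.eq_of_linearisationSetoid (Quotient.exact hψ))⟩

end Obstruction

end
end EquivariantSheaves

theorem mainTheorem3 {G : Type} [Group G] [Finite G] (X : Scheme.{0})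
    [X.Over EquivariantSheaves.SpecC] [Smooth (X ↘ EquivariantSheaves.SpecC)]
    (hX : EquivariantSheaves.IsProjective X)
    (ρ : G →* Aut (X.asOver EquivariantSheaves.SpecC))
    (E : DerivedCategory X.Modules) (hE : EquivariantSheaves.IsBoundedCoherent X E)
    (hsimple : EquivariantSheaves.IsSimple E) (hinv : EquivariantSheaves.IsInvariant ρ E) :
    (∃! ε : groupCohomology.H2 (EquivariantSheaves.unitsRep G),
      EquivariantSheaves.IsObstructionClass ρ E ε) ∧
    ∀ ε : groupCohomology.H2 (EquivariantSheaves.unitsRep G),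
      EquivariantSheaves.IsObstructionClass ρ E ε →
        (Nonempty (EquivariantSheaves.Linearisation ρ E) ↔ ε = 0) ∧
        (ε = 0 →
          Nonempty (EquivariantSheaves.LinearisationClasses ρ E) ∧
          ∀ x y : EquivariantSheaves.LinearisationClasses ρ E,
            ∃! χ : G →* ℂˣ, χ • x = y) := by
  have μ := fun g => (hinv g).some
  obtain ⟨c, hc⟩ := hsimple.exists_isDefect μ
  refine ⟨⟨_, (EquivariantSheaves.isObstructionClass_iff hsimple hc _).2 rfl, fun ε hε =>
    (EquivariantSheaves.isObstructionClass_iff hsimple hc ε).1 hε⟩, fun ε hε => ?_⟩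
  obtain rfl := (EquivariantSheaves.isObstructionClass_iff hsimple hc ε).1 hε
  exact ⟨(hc.H2π_cocycle_eq_zero_iff hsimple).symm, fun h =>
    ⟨((hc.H2π_cocycle_eq_zero_iff hsimple).1 h).map (Quotient.mk _),
      hsimple.existsUnique_character_smul_class⟩⟩
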